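/- Let $K$ be a number field with ring of integers $\mathcal{O}_K$, and let $\mathfrak{B}=\{\mathfrak{b}_\ell:\ell\ge 1\}$ be an infinite collection of proper ideals of $\mathcal{O}_K$ that are pairwise coprime ($\mathfrak{b}_i+\mathfrak{b}_j=\mathcal{O}_K$ for $i\ne j$) and satisfy $\sum_{\ell\ge1}1/N(\mathfrak{b}_\ell)<\infty$, where $N(\mathfrak{b})=|\mathcal{O}_K/\mathfrak{b}|$. Call a set $A\subseteq\mathcal{O}_K$ $\mathfrak{B}$-admissible if, for every $\ell\ge1$, the number of residue classes modulo $\mathfrak{b}_\ell$ that contain an element of $A$ is smaller than $N(\mathfrak{b}_\ell)$. Let $X_{\mathfrak{B}}\subseteq\{0,1\}^{\mathcal{O}_K}$ be the subshift of all $x$ whose support $\{a : x_a=1\}$ is $\mathfrak{B}$-admissible, with the action $(S_a)_{a\in\mathcal{O}_K}$ of the additive group $\mathcal{O}_K$ given by $(S_a x)_b=x_{b+a}$. Then the topological entropy, with logarithms to base $2$, is $$h_{top}\big((S_a)_{a\in\mathcal{O}_K},X_{\mathfrak{B}}\big)=\prod_{\ell\ge1}\Big(1-\frac1{N(\mathfrak{b}_\ell)}\Big).$$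 Here, for a sequence $(F_n)$ of finite subsets of $\mathcal{O}_K$ with $|(g+F_n)\cap F_n|/|F_n|\to1$ for every $g\in\mathcal{O}_K$ (a Følner sequence), the topological entropy is $\sup_{\mathcal{U}}\lim_{n\to\infty}\frac1{|F_n|}\log_2 \mathcal{N}\big(\bigvee_{a\in F_n}S_a^{-1}\mathcal{U}\big)$, the supremum being over all open covers $\mathcal{U}$ of $X_{\mathfrak{B}}$ and $\mathcal{N}(\mathcal{V})$ being the least cardinality of a subcover of $\mathcal{V}$; such sequences exist, and the value is the stated one for each of them, whether the limit is read as an upper or as a lower limit. -/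

import Mathlib

open Filter Topology
open scoped NumberField

namespace BFree

/-! ### Topological entropy of group actions, by open covers -/

section Entropy

variable {G X : Type*}

/-- A Følner sequence of finite subsets of an additive group `G`:
`|(g + F n) ∩ F n| / |F n| → 1` for every `g`. (In particular `F n` is eventually nonempty. The sets
are not required to exhaust `G`.) -/
def IsFoelnerSeq [AddGroup G] (F : ℕ → Finset G) : Prop :=
  ∀ g : G, Tendsto
    (fun n => ((((fun x => g + x) '' (F n : Set G)) ∩ (F n : Set G)).ncard : ℝ) / ((F n).card : ℝ))
    atTop (𝓝 1)

/-- `𝒰` is an open cover of the space `X`. -/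
def IsOpenCover [TopologicalSpace X] (𝒰 : Set (Set X)) : Prop :=
  (∀ U ∈ 𝒰, IsOpen U) ∧ ⋃₀ 𝒰 = Set.univ

/-- The least cardinality of a finite subcover of the cover `𝒰` of `X`
(a finite subcover exists when `X` is compact and `𝒰` is an open cover). -/
noncomputable def coverNumber (𝒰 : Set (Set X)) : ℕ :=
  sInf {n | ∃ 𝒱 : Set (Set X), 𝒱 ⊆ 𝒰 ∧ 𝒱.Finite ∧ ⋃₀ 𝒱 = Set.univ ∧ 𝒱.ncard = n}

/-- The common refinement `⋁_{g ∈ F} T_g⁻¹ 𝒰` of the preimages of the cover `𝒰`, for `g ∈ F`. -/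
def coverJoin (T : G → X → X) (𝒰 : Set (Set X)) (F : Finset G) : Set (Set X) :=
  {W | ∃ U : G → Set X, (∀ g ∈ F, U g ∈ 𝒰) ∧ W = ⋂ g ∈ F, T g ⁻¹' U g}

/-- `(1 / |F|) log₂ N(⋁_{g ∈ F} T_g⁻¹ 𝒰)`. -/
noncomputable def coverRate (T : G → X → X) (𝒰 : Set (Set X)) (F : Finset G) : ℝ :=
  Real.logb 2 (coverNumber (coverJoin T 𝒰 F)) / (F.card : ℝ)

/-- The topological entropy (base `2`) of the action `T` along `F`, with upper limits:
`sup_𝒰 limsup_n (1 / |F n|) log₂ N(⋁_{g ∈ F n} T_g⁻¹ 𝒰)`, over all open covers `𝒰` of `X`. -/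
noncomputable def topEntropySup [TopologicalSpace X] (T : G → X → X) (F : ℕ → Finset G) : EReal :=
  ⨆ (𝒰 : Set (Set X)) (_ : IsOpenCover 𝒰),
    limsup (fun n => ((coverRate T 𝒰 (F n) : ℝ) : EReal)) atTop

/-- The same with lower limits. -/
noncomputable def topEntropyInf [TopologicalSpace X] (T : G → X → X) (F : ℕ → Finset G) : EReal :=
  ⨆ (𝒰 : Set (Set X)) (_ : IsOpenCover 𝒰),
    liminf (fun n => ((coverRate T 𝒰 (F n) : ℝ) : EReal)) atTop

/-- `h` is the topological entropy `h_top((T_g)_{g ∈ G}, X)` of the action `T` of `G` on the compact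
space `X`: Følner sequences exist in `G`, and along each of them the entropy defined by open
covers is `h`, whether it is formed with upper or with lower limits. At most one `h` qualifies. -/
def HasTopEntropy [AddGroup G] [TopologicalSpace X] (T : G → X → X) (h : EReal) : Prop :=
  (∃ F : ℕ → Finset G, IsFoelnerSeq F) ∧
    ∀ F : ℕ → Finset G, IsFoelnerSeq F → topEntropySup T F = h ∧ topEntropyInf T F = h

end Entropy

/-- The action of the group `G` on a subshift `Y ⊆ A^G` by the shifts `(S_a x) b = x (a + b)`. -/
def shiftOn {A G : Type*} [TopologicalSpace A] [AddMonoid G]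
    (Y : SymbolicDynamics.FullShift.Subshift A G) (a : G) : Y.carrier → Y.carrier :=
  (Y.mapsTo a).restrict (SymbolicDynamics.FullShift.shift a) Y.carrier Y.carrier

/-! ### Admissible sequences -/

section Admissible

variable {K : Type*} [Field K] [NumberField K]

/-- `D(𝔞 | A)`: the number of residue classes modulo `𝔞` met by `A`. -/
noncomputable def residueCount (𝔞 : Ideal (𝓞 K)) (A : Set (𝓞 K)) : ℕ :=
  (Ideal.Quotient.mk 𝔞 '' A).ncard

/-- `A` is `𝔅`-admissible, for `𝔅 = {𝔟 ℓ}`: `D(𝔟 ℓ | A) < N(𝔟 ℓ)` for every `ℓ`. -/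
def IsAdmissible (𝔟 : ℕ → Ideal (𝓞 K)) (A : Set (𝓞 K)) : Prop :=
  ∀ ℓ, residueCount (𝔟 ℓ) A < Ideal.absNorm (𝔟 ℓ)

/-- For a nonzero ideal, `D(𝔞 | A) < N(𝔞)` means that `A` misses a residue class. -/
lemma residueCount_lt_iff {𝔞 : Ideal (𝓞 K)} (h𝔞 : 𝔞 ≠ ⊥) (A : Set (𝓞 K)) :
    residueCount 𝔞 A < Ideal.absNorm 𝔞 ↔
      ∃ c : 𝓞 K ⧸ 𝔞, ∀ a ∈ A, Ideal.Quotient.mk 𝔞 a ≠ c := by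
  have : Finite (𝓞 K ⧸ 𝔞) := Ideal.finiteQuotientOfFreeOfNeBot 𝔞 h𝔞
  have hN : Ideal.absNorm 𝔞 = Nat.card (𝓞 K ⧸ 𝔞) := by
    rw [Ideal.absNorm_apply, Submodule.cardQuot_apply]
  rw [hN, residueCount]
  constructor
  · intro h
    by_contra! hc
    have hu : Ideal.Quotient.mk 𝔞 '' A = Set.univ := by
      ext c
      simpa using hc c
    rw [hu, Set.ncard_univ] at h
    exact lt_irrefl _ h
  · rintro ⟨c, hc⟩
    rw [← Set.ncard_univ]
    refine Set.ncard_lt_ncard ?_ Set.finite_univ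
    rw [Set.ssubset_univ_iff]
    intro hu
    obtain ⟨a, ha, hac⟩ : c ∈ Ideal.Quotient.mk 𝔞 '' A := hu ▸ Set.mem_univ c
    exact hc a ha hac

/-- `X_𝔅`: the subshift of all `x ∈ {0,1}^{𝓞 K}` whose support is `𝔅`-admissible. -/
def admissibleSubshift (𝔟 : ℕ → Ideal (𝓞 K)) :
    SymbolicDynamics.FullShift.Subshift (Fin 2) (𝓞 K) where
  carrier := {x | IsAdmissible 𝔟 (Function.support x)}
  isClosed := by
    simp only [IsAdmissible, Set.ofPred_forall]
    refine isClosed_iInter fun ℓ => ?_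
    by_cases h : 𝔟 ℓ = ⊥
    · simp [h]
    have : Finite (𝓞 K ⧸ 𝔟 ℓ) := Ideal.finiteQuotientOfFreeOfNeBot _ h
    simp only [residueCount_lt_iff h, Set.ofPred_exists]
    refine isClosed_iUnion_of_finite fun c => ?_
    have hs : {x : 𝓞 K → Fin 2 | ∀ a ∈ Function.support x, Ideal.Quotient.mk (𝔟 ℓ) a ≠ c} =
        ⋂ (a : 𝓞 K) (_ : Ideal.Quotient.mk (𝔟 ℓ) a = c), {x | x a = 0} := by
      ext x
      simp only [Function.mem_support, Set.mem_ofPred_eq, Set.mem_iInter]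
      exact forall_congr' fun a => by tauto
    rw [hs]
    exact isClosed_iInter fun a => isClosed_iInter fun _ =>
      isClosed_eq (continuous_apply a) continuous_const
  mapsTo := by
    intro g x hx ℓ
    have hℓ := hx ℓ
    by_cases h : 𝔟 ℓ = ⊥
    · simp [h] at hℓ
    rw [residueCount_lt_iff h] at hℓ ⊢
    obtain ⟨c, hc⟩ := hℓ
    refine ⟨c - Ideal.Quotient.mk (𝔟 ℓ) g, fun a ha hac => hc (g + a) ?_ ?_⟩
    · simpa using ha
    · rw [map_add, hac]
      ring

end Admissible

end BFree

/-! Write `p_L` for the product of `1 - 1 / N(𝔟 ℓ)` over `ℓ < L`; these products decrease to `h`.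

Lower bound: deleting from a finite set `F` the least populated class modulo each `𝔟 ℓ` in turn
leaves some `A ⊆ F` with at least `h * |F|` elements that misses a class modulo every ideal
(`exists_subset_avoiding`). All `2 ^ |A|` subsets of `A` are then admissible, and the partition by
the coordinate at the origin separates them (`two_pow_card_le_coverNumber`). This works for every
nonempty `F`.

Upper bound: by compactness an open cover is refined by the patterns on a finite window `W`
(`exists_window`), so it suffices to count patterns on `F n` together with `F n + W`, which adds
only `o(|F n|)` points. A pattern is a subset of what survives after omitting one class modulo each
of the first `L` ideals. The number of choices of classes does not depend on `n`. By the Chinese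
remainder theorem and the asymptotic invariance of `F n`, at most `(p_L + ε) * |F n|` points of `F
n` survive (`IsFoelnerSeq.eventually_card_avoiding_le`). Hence the rate is at most `p_L` in the
limit, for every `L`. -/

namespace BFree

/-! ### Følner sequences -/

section Foelner

open scoped Classical in
/-- Along a Følner sequence the proportion of a translate lying outside the set tends to `0`. -/
lemma IsFoelnerSeq.eventually_card_sdiff_le {G : Type*} [AddGroup G] {F : ℕ → Finset G}
    (hF : IsFoelnerSeq F) (g : G) {ε : ℝ} (hε : 0 < ε) :
    ∀ᶠ n in atTop, (((F n).image (g + ·) \ F n).card : ℝ) ≤ ε * (F n).card := by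
  have h1 : ∀ᶠ n in atTop, 1 - ε < _ := (hF g).eventually (lt_mem_nhds (by linarith))
  filter_upwards [h1] with n hn
  have hinter : (((fun x => g + x) '' (F n : Set G)) ∩ (F n : Set G)).ncard
      = ((F n).image (g + ·) ∩ F n).card := by
    rw [← Set.ncard_coe_finset]
    simp
  rw [hinter] at hn
  have hcard : ((F n).image (g + ·) \ F n).card + ((F n).image (g + ·) ∩ F n).card
      = (F n).card := by
    rw [Finset.card_sdiff_add_card_inter, Finset.card_image_of_injective _ (add_right_injective g)]
  have hcard' : (((F n).image (g + ·) \ F n).card : ℝ) + (((F n).image (g + ·) ∩ F n).card : ℝ)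
      = (F n).card := by exact_mod_cast hcard
  rcases (F n).card.eq_zero_or_pos with h0 | hpos
  · simp only [h0] at hcard ⊢
    have : ((F n).image (g + ·) \ F n).card = 0 := by omega
    rw [this]
    simp
  · have hpos' : (0 : ℝ) < (F n).card := by exact_mod_cast hpos
    rw [lt_div_iff₀ hpos'] at hn
    linarith

/-- For an empty set the Følner ratio is `0 / 0 = 0`, which stays away from the limit `1`. -/
lemma IsFoelnerSeq.eventually_card_pos {G : Type*} [AddGroup G] {F : ℕ → Finset G}
    (hF : IsFoelnerSeq F) : ∀ᶠ n in atTop, 0 < (F n).card := by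
  have h1 : ∀ᶠ n in atTop, (0 : ℝ) < _ := (hF 0).eventually (lt_mem_nhds one_pos)
  filter_upwards [h1] with n hn
  rw [Nat.pos_iff_ne_zero]
  intro h0
  simp [h0] at hn

open scoped Classical in
/-- Følner sequences are asymptotically at most equidistributed in the classes of a finite
quotient. -/
lemma IsFoelnerSeq.eventually_card_filter_le {G Q : Type*} [AddCommGroup G] [AddCommGroup Q]
    [Fintype Q] {F : ℕ → Finset G} (hF : IsFoelnerSeq F) (φ : G →+ Q)
    (hφ : Function.Surjective φ) {ε : ℝ} (hε : 0 < ε) :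
    ∀ᶠ n in atTop, ∀ q : Q,
      (((F n).filter (φ · = q)).card : ℝ) ≤ (1 / Fintype.card Q + ε) * (F n).card := by
  choose s hs using hφ
  have h1 : ∀ᶠ n in atTop, ∀ q : Q,
      (((F n).image (s q + ·) \ F n).card : ℝ) ≤ ε * (F n).card :=
    eventually_all.2 fun q => hF.eventually_card_sdiff_le (s q) hε
  filter_upwards [h1] with n hn q
  have hQ : (0 : ℝ) < Fintype.card Q := by exact_mod_cast Fintype.card_pos
  -- Translation by a lift of `r - q` sends the fibre over `q` injectively into the fibre over `r`,
  -- up to points that leave `F n`. Averaging over `r` then gives the bound.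
  have key : ∀ r : Q, (((F n).filter (φ · = q)).card : ℝ)
      ≤ ((F n).filter (φ · = r)).card + ε * (F n).card := by
    intro r
    refine le_trans ?_ (add_le_add_right (hn (r - q)) _)
    rw [← Finset.card_image_of_injective ((F n).filter (φ · = q))
      (add_right_injective (s (r - q)))]
    norm_cast
    refine le_trans (Finset.card_le_card ?_) (Finset.card_union_le _ _)
    intro x hx
    simp only [Finset.mem_image, Finset.mem_filter, Finset.mem_union, Finset.mem_sdiff] at hx ⊢
    obtain ⟨y, ⟨hy, rfl⟩, rfl⟩ := hx
    by_cases hx : s (r - φ y) + y ∈ F n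
    · exact Or.inl ⟨hx, by simp [hs]⟩
    · exact Or.inr ⟨⟨y, hy, rfl⟩, hx⟩
  have hsum : ∑ r : Q, (((F n).filter (φ · = r)).card : ℝ) = (F n).card := by
    exact_mod_cast (Finset.card_eq_sum_card_fiberwise (f := φ) (t := Finset.univ)
      (fun _ _ => by simp)).symm
  have h2 := Finset.sum_le_sum fun r (_ : r ∈ Finset.univ) => key r
  rw [Finset.sum_add_distrib, hsum] at h2
  simp only [Finset.sum_const, Finset.card_univ, nsmul_eq_mul] at h2
  have h3 : (Fintype.card Q : ℝ) * ((F n).filter (φ · = q)).card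
      ≤ Fintype.card Q * ((1 / Fintype.card Q + ε) * (F n).card) := by
    refine h2.trans (le_of_eq ?_)
    field_simp
  exact le_of_mul_le_mul_left h3 hQ

/-- A Følner sequence has at least half as many elements, eventually, as any finite quotient. -/
lemma IsFoelnerSeq.eventually_card_quotient_le {G Q : Type*} [AddCommGroup G] [AddCommGroup Q]
    [Fintype Q] {F : ℕ → Finset G} (hF : IsFoelnerSeq F) (φ : G →+ Q)
    (hφ : Function.Surjective φ) :
    ∀ᶠ n in atTop, (Fintype.card Q : ℝ) ≤ 2 * (F n).card := by
  classical
  have hQ : (0 : ℝ) < Fintype.card Q := by exact_mod_cast Fintype.card_pos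
  filter_upwards [hF.eventually_card_filter_le φ hφ (ε := 1 / Fintype.card Q) (by positivity),
    hF.eventually_card_pos] with n hn hpos
  obtain ⟨x, hx⟩ := Finset.card_pos.1 hpos
  have h1 : 1 ≤ ((F n).filter (φ · = φ x)).card :=
    Finset.card_pos.2 ⟨x, by simp [hx]⟩
  have h2 : (1 : ℝ) ≤ ((F n).filter (φ · = φ x)).card := by exact_mod_cast h1
  have h3 := h2.trans (hn (φ x))
  have h4 : (Fintype.card Q : ℝ) * 1
      ≤ Fintype.card Q * ((1 / Fintype.card Q + 1 / Fintype.card Q) * (F n).card) := by gcongr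
  refine (mul_one (Fintype.card Q : ℝ)).symm.le.trans (h4.trans (le_of_eq ?_))
  field_simp
  ring

/-- The boxes `[0, n)^ι` form a Følner sequence of `ℤ^ι`. -/
lemma isFoelnerSeq_box (ι : Type*) [Fintype ι] [DecidableEq ι] :
    IsFoelnerSeq fun n : ℕ => Fintype.piFinset fun _ : ι => Finset.Ico (0 : ℤ) n := by
  intro g
  have hset : ∀ n : ℕ, (fun x => g + x) ''
      (Fintype.piFinset fun _ : ι => Finset.Ico (0 : ℤ) n : Finset (ι → ℤ)) ∩
      (Fintype.piFinset fun _ : ι => Finset.Ico (0 : ℤ) n : Finset (ι → ℤ)) =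
      (Fintype.piFinset fun i => Finset.Ico (max 0 (g i)) (min n (n + g i)) : Finset (ι → ℤ)) := by
    intro n
    ext x
    simp only [Set.mem_inter_iff, Set.mem_image, Finset.mem_coe, Fintype.mem_piFinset,
      Finset.mem_Ico]
    constructor
    · rintro ⟨⟨y, hy, rfl⟩, hx⟩ i
      have := hy i
      have := hx i
      simp only [Pi.add_apply] at this ⊢
      omega
    · intro hx
      refine ⟨⟨x - g, fun i => ?_, by simp⟩, fun i => ?_⟩
      · have := hx i
        simp only [Pi.sub_apply]
        omega
      · have := hx i
        omega
  -- The side lengths are `n - |g i|`; truncated subtraction matches the empty interval when `n < |g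
  -- i|`.
  have hprod : (fun n : ℕ => ((((fun x => g + x) ''
      (Fintype.piFinset fun _ : ι => Finset.Ico (0 : ℤ) n : Finset (ι → ℤ))) ∩
      (Fintype.piFinset fun _ : ι => Finset.Ico (0 : ℤ) n : Finset (ι → ℤ))).ncard : ℝ) /
      ((Fintype.piFinset fun _ : ι => Finset.Ico (0 : ℤ) n).card : ℝ)) =
      fun n : ℕ => ∏ i, (((n - (g i).natAbs : ℕ) : ℝ) / n) := by
    funext n
    rw [hset, Set.ncard_coe_finset, Fintype.card_piFinset, Fintype.card_piFinset,
      Finset.prod_div_distrib]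
    push_cast
    congr 1
    · refine Finset.prod_congr rfl fun i _ => ?_
      rw [Int.card_Ico]
      congr 1
      omega
    · simp
  rw [hprod, ← Finset.prod_const_one (ι := ι) (s := Finset.univ)]
  refine tendsto_finsetProd _ fun i _ => ?_
  have h1 : Tendsto (fun n : ℕ => 1 - ((g i).natAbs : ℝ) / n) atTop (𝓝 (1 - 0)) :=
    tendsto_const_nhds.sub (tendsto_const_div_atTop_nhds_zero_nat _)
  rw [sub_zero] at h1
  refine h1.congr' ?_
  filter_upwards [eventually_ge_atTop ((g i).natAbs + 1)] with n hn
  rw [Nat.cast_sub (by omega)]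
  have : (n : ℝ) ≠ 0 := by
    have : n ≠ 0 := by omega
    exact_mod_cast this
  field_simp

lemma IsFoelnerSeq.map_equiv {G H : Type*} [AddGroup G] [AddGroup H] {F : ℕ → Finset G}
    (hF : IsFoelnerSeq F) (e : G ≃+ H) :
    IsFoelnerSeq fun n => (F n).map e.toEquiv.toEmbedding := by
  intro h
  refine (hF (e.symm h)).congr fun n => ?_
  rw [Finset.card_map, ← Set.ncard_image_of_injective _ e.injective, Set.image_inter e.injective]
  congr 4
  · ext x
    simp only [Set.mem_image, Finset.mem_coe, Finset.coe_map]
    constructor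
    · rintro ⟨_, ⟨y, hy, rfl⟩, rfl⟩
      exact ⟨e y, ⟨y, hy, rfl⟩, by simp⟩
    · rintro ⟨_, ⟨y, hy, rfl⟩, rfl⟩
      exact ⟨_, ⟨y, hy, rfl⟩, by simp⟩
  · simp

lemma exists_isFoelnerSeq_ringOfIntegers (K : Type*) [Field K] [NumberField K] :
    ∃ F : ℕ → Finset (𝓞 K), IsFoelnerSeq F := by
  classical
  exact ⟨_, (isFoelnerSeq_box _).map_equiv
    (NumberField.RingOfIntegers.basis K).equivFun.symm.toAddEquiv⟩

end Foelner

/-! ### Cover numbers of binary subshifts -/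

section Cover

/-- The least cardinality of a finite subcover is attained when there is one. -/
lemma le_coverNumber {X : Type*} {𝒰 : Set (Set X)} {m : ℕ}
    (hex : ∃ 𝒱 : Set (Set X), 𝒱 ⊆ 𝒰 ∧ 𝒱.Finite ∧ ⋃₀ 𝒱 = Set.univ)
    (h : ∀ 𝒱 : Set (Set X), 𝒱 ⊆ 𝒰 → 𝒱.Finite → ⋃₀ 𝒱 = Set.univ → m ≤ 𝒱.ncard) :
    m ≤ coverNumber 𝒰 := by
  obtain ⟨𝒱, h1, h2, h3⟩ := hex
  refine le_csInf ⟨_, 𝒱, h1, h2, h3, rfl⟩ ?_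
  rintro n ⟨𝒱, h1, h2, h3, rfl⟩
  exact h 𝒱 h1 h2 h3

/-- The support of `x` within `E`. -/
def trace {G : Type*} (E : Finset G) (x : G → Fin 2) : Finset G := E.filter (x · ≠ 0)

lemma trace_eq_trace_iff {G : Type*} {E : Finset G} {x y : G → Fin 2} :
    trace E x = trace E y ↔ ∀ a ∈ E, x a = y a := by
  simp only [trace, Finset.ext_iff, Finset.mem_filter]
  refine forall_congr' fun a => ?_
  constructor
  · intro h ha
    simp only [ha, true_and] at h
    revert h
    generalize x a = u
    generalize y a = v
    revert u v
    decide
  · intro h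
    refine and_congr_right fun ha => ?_
    rw [h ha]

lemma finite_image_trace {G : Type*} (E : Finset G) (Z : Set (G → Fin 2)) : (trace E '' Z).Finite := by
  refine E.powerset.finite_toSet.subset ?_
  rintro _ ⟨x, -, rfl⟩
  exact Finset.mem_coe.2 (Finset.mem_powerset.2 (Finset.filter_subset _ _))

variable {G : Type*} [AddMonoid G] (Y : SymbolicDynamics.FullShift.Subshift (Fin 2) G)

@[simp]
lemma shiftOn_apply (a b : G) (x : Y.carrier) :
    (shiftOn Y a x).1 b = x.1 (a + b) := rfl

instance : CompactSpace Y.carrier := isCompact_iff_compactSpace.1 Y.isClosed.isCompact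

/-- The number of patterns of `Y` on the window `E`. -/
noncomputable def traceCount (E : Finset G) : ℕ := (trace E '' Y.carrier).ncard

/-- Every open cover of a subshift is refined by the partition into the patterns on some window. -/
lemma exists_window {𝒰 : Set (Set Y.carrier)} (h𝒰 : IsOpenCover 𝒰) :
    ∃ W : Finset G, ∀ x : Y.carrier, ∃ U ∈ 𝒰, ∀ y : Y.carrier,
      (∀ w ∈ W, y.1 w = x.1 w) → y ∈ U := by
  classical
  have hloc : ∀ x : Y.carrier, ∃ W : Finset G, ∃ U ∈ 𝒰, ∀ y : Y.carrier,
      (∀ w ∈ W, y.1 w = x.1 w) → y ∈ U := by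
    intro x
    obtain ⟨U, hU, hxU⟩ : x ∈ ⋃₀ 𝒰 := h𝒰.2 ▸ Set.mem_univ x
    obtain ⟨V, hV, rfl⟩ := isOpen_induced_iff.1 (h𝒰.1 U hU)
    obtain ⟨I, u, hu, hIV⟩ := isOpen_pi_iff.1 hV x.1 hxU
    refine ⟨I, _, hU, fun y hy => hIV ?_⟩
    intro a ha
    rw [hy a ha]
    exact (hu a ha).2
  choose W U hU hW using hloc
  have hopen : ∀ x : Y.carrier, IsOpen {y : Y.carrier | ∀ w ∈ W x, y.1 w = x.1 w} := fun x =>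
    (SymbolicDynamics.FullShift.isOpen_cylinder (W x) x.1).preimage continuous_subtype_val
  obtain ⟨t, ht⟩ := isCompact_univ.elim_finite_subcover _ hopen
    (fun x _ => Set.mem_iUnion.2 ⟨x, fun _ _ => rfl⟩)
  refine ⟨t.biUnion W, fun x => ?_⟩
  obtain ⟨z, hz, hxz⟩ := Set.mem_iUnion₂.1 (ht (Set.mem_univ x))
  refine ⟨U z, hU z, fun y hy => hW z y fun w hw => ?_⟩
  rw [hy w (Finset.mem_biUnion.2 ⟨z, hz, hw⟩)]
  exact hxz w hw

/-- If the patterns on `W` refine `𝒰`, the patterns on `E ⊇ F + W` refine the join of `𝒰` over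
`F`. -/
lemma exists_subcover_coverJoin {𝒰 : Set (Set Y.carrier)} {W E F : Finset G}
    (hW : ∀ x : Y.carrier, ∃ U ∈ 𝒰, ∀ y : Y.carrier, (∀ w ∈ W, y.1 w = x.1 w) → y ∈ U)
    (hE : ∀ a ∈ F, ∀ w ∈ W, a + w ∈ E) :
    ∃ 𝒱 : Set (Set Y.carrier), 𝒱 ⊆ coverJoin (shiftOn Y) 𝒰 F ∧ 𝒱.Finite ∧ ⋃₀ 𝒱 = Set.univ ∧
      𝒱.ncard ≤ traceCount Y E := by
  choose U hU hWU using hW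
  have hrep : ∀ s ∈ trace E '' Y.carrier, ∃ x : Y.carrier, trace E x.1 = s := by
    rintro _ ⟨x, hx, rfl⟩
    exact ⟨⟨x, hx⟩, rfl⟩
  cases isEmpty_or_nonempty Y.carrier
  · exact ⟨∅, Set.empty_subset _, Set.finite_empty, Set.eq_univ_of_forall isEmptyElim, by simp⟩
  choose! r hr using hrep
  -- One member of the join per pattern, read off from a chosen point `r s` with that pattern.
  let V : Finset G → Set Y.carrier := fun s => ⋂ g ∈ F, shiftOn Y g ⁻¹' U (shiftOn Y g (r s))
  refine ⟨V '' (trace E '' Y.carrier), ?_, (finite_image_trace E _).image _, ?_,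
    Set.ncard_image_le (finite_image_trace E _)⟩
  · rintro _ ⟨s, -, rfl⟩
    exact ⟨fun g => U (shiftOn Y g (r s)), fun _ _ => hU _, rfl⟩
  · refine Set.eq_univ_of_forall fun x => ?_
    have hx : trace E x.1 ∈ trace E '' Y.carrier := ⟨x.1, x.2, rfl⟩
    refine ⟨_, Set.mem_image_of_mem V hx, Set.mem_iInter₂.2 fun g hg => ?_⟩
    refine hWU _ _ fun w hw => ?_
    exact (trace_eq_trace_iff.1 (hr _ hx) _ (hE g hg w hw)).symm

lemma coverNumber_le_traceCount {𝒰 : Set (Set Y.carrier)} {W E F : Finset G}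
    (hW : ∀ x : Y.carrier, ∃ U ∈ 𝒰, ∀ y : Y.carrier, (∀ w ∈ W, y.1 w = x.1 w) → y ∈ U)
    (hE : ∀ a ∈ F, ∀ w ∈ W, a + w ∈ E) :
    coverNumber (coverJoin (shiftOn Y) 𝒰 F) ≤ traceCount Y E := by
  obtain ⟨𝒱, h1, h2, h3, h4⟩ := exists_subcover_coverJoin Y hW hE
  refine le_trans (Nat.sInf_le ?_) h4
  exact ⟨𝒱, h1, h2, h3, rfl⟩

/-- The partition of `Y` according to the coordinate at the origin. -/
def originCover : Set (Set Y.carrier) := Set.range fun i : Fin 2 => {x : Y.carrier | x.1 0 = i}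

lemma isOpenCover_originCover : IsOpenCover (originCover Y) := by
  constructor
  · rintro _ ⟨i, rfl⟩
    have hcont : Continuous fun x : Y.carrier => x.1 0 :=
      (continuous_apply 0).comp continuous_subtype_val
    exact (isOpen_discrete {i}).preimage hcont
  · exact Set.eq_univ_of_forall fun x => ⟨{y | y.1 0 = x.1 0}, ⟨x.1 0, rfl⟩, rfl⟩

/-- If all subsets of `A ⊆ F` are supports of points of `Y`, the join over `F` of the partition at
the origin needs at least `2 ^ |A|` elements to cover `Y`. -/
lemma two_pow_card_le_coverNumber {A F : Finset G} (hAF : A ⊆ F)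
    (hA : ∀ x : G → Fin 2, Function.support x ⊆ A → x ∈ Y.carrier) :
    2 ^ A.card ≤ coverNumber (coverJoin (shiftOn Y) (originCover Y) F) := by
  classical
  refine le_coverNumber ?_ ?_
  -- A finite subcover must be exhibited, since `sInf ∅ = 0`; the window `{0}` suffices.
  · have hW : ∀ x : Y.carrier, ∃ U ∈ originCover Y, ∀ y : Y.carrier,
        (∀ w ∈ ({0} : Finset G), y.1 w = x.1 w) → y ∈ U := fun x =>
      ⟨_, ⟨x.1 0, rfl⟩, fun y hy => hy 0 (by simp)⟩
    obtain ⟨𝒱, h1, h2, h3, -⟩ := exists_subcover_coverJoin Y (E := F) (F := F) hW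
      (fun a ha w hw => by simpa [Finset.mem_singleton.1 hw] using ha)
    exact ⟨𝒱, h1, h2, h3⟩
  · intro 𝒱 hsub hfin hcov
    let χ : Finset G → G → Fin 2 := fun s a => if a ∈ s then 1 else 0
    have hχ : ∀ s ∈ A.powerset, χ s ∈ Y.carrier := by
      intro s hs
      refine hA _ fun a ha => ?_
      by_contra hna
      exact ha (if_neg fun h => hna (Finset.mem_powerset.1 hs h))
    have hV : ∀ s ∈ A.powerset, ∃ V ∈ 𝒱, ∃ x ∈ V, x.1 = χ s := by
      intro s hs
      obtain ⟨V, hV, hx⟩ : (⟨χ s, hχ s hs⟩ : Y.carrier) ∈ ⋃₀ 𝒱 := hcov ▸ Set.mem_univ _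
      exact ⟨V, hV, _, hx, rfl⟩
    choose! V hV𝒱 x hx hxχ using hV
    rw [← Finset.card_powerset, ← Set.ncard_coe_finset]
    refine Set.ncard_le_ncard_of_injOn V (fun s hs => hV𝒱 s hs) ?_ hfin
    intro s hs t ht hst
    obtain ⟨U, hU, hVU⟩ := hsub (hV𝒱 s hs)
    have hs' := hx s hs
    have ht' := hx t ht
    rw [← hst, hVU] at ht'
    rw [hVU] at hs'
    -- A member of the join prescribes every coordinate in `F`, so it contains at most one of the
    -- points `χ s`.
    have hagree : ∀ a ∈ F, χ s a = χ t a := by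
      intro a ha
      obtain ⟨i, hi⟩ := hU a ha
      have h1 := Set.mem_iInter₂.1 hs' a ha
      have h2 := Set.mem_iInter₂.1 ht' a ha
      rw [← hi] at h1 h2
      simp only [Set.mem_preimage, Set.mem_ofPred_eq, shiftOn_apply, add_zero] at h1 h2
      rw [← hxχ s hs, ← hxχ t ht, h1, h2]
    ext a
    by_cases ha : a ∈ F
    · have := hagree a ha
      simp only [χ] at this
      by_cases has : a ∈ s <;> by_cases hat : a ∈ t <;> simp_all
    · exact iff_of_false (fun h => ha (hAF (Finset.mem_powerset.1 hs h)))
        (fun h => ha (hAF (Finset.mem_powerset.1 ht h)))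

end Cover

/-! ### Admissible sets -/

section Admissible

/-- Greedy removal of residue classes: a finite set can be thinned so as to miss a class modulo each
of countably many finite quotients, while keeping the expected proportion of its elements. -/
lemma exists_subset_avoiding {G : Type*} {Q : ℕ → Type*} [∀ ℓ, Finite (Q ℓ)] [∀ ℓ, Nonempty (Q ℓ)]
    (φ : ∀ ℓ, G → Q ℓ) (F : Finset G) {h : ℝ}
    (hh : ∀ L, h ≤ ∏ ℓ ∈ Finset.range L, (1 - 1 / (Nat.card (Q ℓ) : ℝ))) :
    ∃ A ⊆ F, h * F.card ≤ A.card ∧ ∀ ℓ, ∃ c, ∀ a ∈ A, φ ℓ a ≠ c := by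
  classical
  have := fun ℓ => Fintype.ofFinite (Q ℓ)
  have step : ∀ (ℓ : ℕ) (B : Finset G), ∃ c : Q ℓ,
      (1 - 1 / (Nat.card (Q ℓ) : ℝ)) * B.card ≤ (B.filter (φ ℓ · ≠ c)).card := by
    intro ℓ B
    have hQ : (Fintype.card (Q ℓ) : ℝ) ≠ 0 := by exact_mod_cast Fintype.card_ne_zero
    obtain ⟨c, -, hc⟩ := Finset.exists_card_fiber_le_of_card_le_nsmul (s := B)
      (t := (Finset.univ : Finset (Q ℓ))) (f := φ ℓ) (b := (B.card : ℝ) / Fintype.card (Q ℓ))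
      Finset.univ_nonempty
      (by rw [Finset.card_univ, nsmul_eq_mul, mul_div_cancel₀ _ hQ])
    refine ⟨c, ?_⟩
    have hsplit : ((B.filter (φ ℓ · = c)).card : ℝ) + (B.filter (φ ℓ · ≠ c)).card = B.card := by
      exact_mod_cast Finset.card_filter_add_card_filter_not (s := B) (φ ℓ · = c)
    rw [Nat.card_eq_fintype_card, sub_mul, one_mul, one_div_mul_eq_div]
    linarith
  choose c hc using step
  let A : ℕ → Finset G := fun L => L.rec F fun ℓ B => B.filter (φ ℓ · ≠ c ℓ B)
  have hA : ∀ ℓ, A (ℓ + 1) = (A ℓ).filter (φ ℓ · ≠ c ℓ (A ℓ)) := fun ℓ => rfl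
  have hanti : Antitone A := antitone_nat_of_succ_le fun ℓ => by
    rw [hA]
    exact Finset.filter_subset _ _
  -- A decreasing sequence of finite sets stabilises, so one stage avoids the chosen classes for all
  -- `ℓ` at once.
  obtain ⟨N, hN⟩ := WellFoundedLT.antitone_chain_condition hanti
  have hcard : ∀ L, (∏ ℓ ∈ Finset.range L, (1 - 1 / (Nat.card (Q ℓ) : ℝ))) * F.card
      ≤ (A L).card := by
    intro L
    induction L with
    | zero => simp [A]
    | succ L ih =>
      rw [Finset.prod_range_succ, hA, mul_right_comm, mul_comm]
      refine le_trans (mul_le_mul_of_nonneg_left ih ?_) (hc L (A L))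
      have : (1 : ℝ) ≤ Nat.card (Q L) := by exact_mod_cast Nat.card_pos
      rw [sub_nonneg, div_le_one (by linarith)]
      exact this
  refine ⟨A N, hanti (Nat.zero_le N), ?_, fun ℓ => ⟨c ℓ (A ℓ), fun a ha => ?_⟩⟩
  · exact le_trans (mul_le_mul_of_nonneg_right (hh N) (Nat.cast_nonneg _)) (hcard N)
  · have ha' : a ∈ A (ℓ + 1) := by
      rcases le_total N (ℓ + 1) with h | h
      · rwa [← hN _ h]
      · exact hanti h ha
    rw [hA] at ha'
    exact (Finset.mem_filter.1 ha').2

end Admissible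

/-! ### Density of the points avoiding given residue classes -/

section Density

open scoped Classical in
/-- Along a Følner sequence, the upper density of the elements avoiding one class modulo each of
finitely many independent finite quotients is at most the product of the densities. -/
lemma IsFoelnerSeq.eventually_card_avoiding_le {G ι : Type*} [AddCommGroup G] [Fintype ι]
    {Q : ι → Type*} [∀ i, AddCommGroup (Q i)] [∀ i, Finite (Q i)] {F : ℕ → Finset G}
    (hF : IsFoelnerSeq F) (φ : ∀ i, G →+ Q i)
    (hφ : Function.Surjective fun (a : G) i => φ i a) {ε : ℝ} (hε : 0 < ε) :
    ∀ᶠ n in atTop, ∀ c : ∀ i, Q i, (((F n).filter fun a => ∀ i, φ i a ≠ c i).card : ℝ) ≤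
      (∏ i, (1 - 1 / (Nat.card (Q i) : ℝ)) + ε) * (F n).card := by
  have := fun i => Fintype.ofFinite (Q i)
  have hN : ∀ i, (0 : ℝ) < Fintype.card (Q i) := fun i => by exact_mod_cast Fintype.card_pos
  have hQ : (0 : ℝ) < Fintype.card (∀ i, Q i) := by exact_mod_cast Fintype.card_pos
  obtain ⟨Φ, hΦ⟩ : ∃ Φ : G →+ ∀ i, Q i, ∀ a i, Φ a i = φ i a :=
    ⟨AddMonoidHom.mk' (fun a i => φ i a) (fun a b => by ext; simp), fun _ _ => rfl⟩
  have hΦ' : Function.Surjective Φ := fun x => (hφ x).imp fun a ha => by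
    rw [← ha]
    exact funext fun i => hΦ a i
  -- The error is divided by the size of the product quotient because it is summed over the classes
  -- in `S`.
  filter_upwards [hF.eventually_card_filter_le Φ hΦ' (ε := ε / Fintype.card (∀ i, Q i))
    (by positivity)] with n hn c
  let S : Finset (∀ i, Q i) := Fintype.piFinset fun i => Finset.univ.erase (c i)
  have hS : (S.card : ℝ) = (∏ i, (1 - 1 / (Nat.card (Q i) : ℝ))) * Fintype.card (∀ i, Q i) := by
    simp only [S, Fintype.card_piFinset, Fintype.card_pi, Finset.card_erase_of_mem,
      Finset.mem_univ, Finset.card_univ, Nat.card_eq_fintype_card]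
    push_cast
    rw [← Finset.prod_mul_distrib]
    refine Finset.prod_congr rfl fun i _ => ?_
    rw [Nat.cast_sub Fintype.card_pos, sub_mul, one_mul, one_div,
      inv_mul_cancel₀ (hN i).ne', Nat.cast_one]
  have hle : (S.card : ℝ) ≤ Fintype.card (∀ i, Q i) := by exact_mod_cast Finset.card_le_univ S
  have hcard : (((F n).filter fun a => ∀ i, φ i a ≠ c i).card : ℝ) ≤
      ∑ q ∈ S, (((F n).filter (Φ · = q)).card : ℝ) := by
    norm_cast
    rw [Finset.card_eq_sum_card_fiberwise (f := Φ) (t := S)]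
    · exact Finset.sum_le_sum fun q _ =>
        Finset.card_le_card (Finset.filter_subset_filter _ (Finset.filter_subset _ _))
    · intro a ha
      simpa [S, hΦ] using (Finset.mem_filter.1 ha).2
  have hsum : ∑ q ∈ S, (((F n).filter (Φ · = q)).card : ℝ) ≤ ∑ q ∈ S,
      (1 / (Fintype.card (∀ i, Q i) : ℝ) + ε / Fintype.card (∀ i, Q i)) * (F n).card :=
    Finset.sum_le_sum fun q _ => (le_of_eq (by congr)).trans (hn q)
  refine hcard.trans (hsum.trans ?_)
  rw [Finset.sum_const, nsmul_eq_mul, ← mul_assoc]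
  refine mul_le_mul_of_nonneg_right ?_ (Nat.cast_nonneg _)
  have hdiv : (S.card : ℝ) / Fintype.card (∀ i, Q i) = ∏ i, (1 - 1 / (Nat.card (Q i) : ℝ)) := by
    rw [hS, mul_div_cancel_right₀ _ hQ.ne']
  have hdiv_le : (S.card : ℝ) / Fintype.card (∀ i, Q i) ≤ 1 := (div_le_one hQ).2 hle
  calc (S.card : ℝ) * (1 / Fintype.card (∀ i, Q i) + ε / Fintype.card (∀ i, Q i))
      = (S.card : ℝ) / Fintype.card (∀ i, Q i) + ε * ((S.card : ℝ) / Fintype.card (∀ i, Q i)) := by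
        ring
    _ ≤ (S.card : ℝ) / Fintype.card (∀ i, Q i) + ε := by
        linarith [mul_le_of_le_one_right hε.le hdiv_le]
    _ = _ := by rw [hdiv]

end Density

/-! ### Entropy bounds for the admissible subshift -/

section Admissible

/-- In an infinite family of pairwise coprime proper ideals, all are nonzero. -/
lemma ne_bot_of_pairwise_isCoprime {R : Type*} [CommRing R] {𝔟 : ℕ → Ideal R}
    (hproper : ∀ ℓ, 𝔟 ℓ ≠ ⊤) (hcoprime : Pairwise fun i j => IsCoprime (𝔟 i) (𝔟 j)) (ℓ : ℕ) : 𝔟 ℓ ≠ ⊥ := by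
  intro h
  have h1 : IsCoprime (𝔟 ℓ) (𝔟 (ℓ + 1)) := hcoprime (Nat.succ_ne_self ℓ).symm
  rw [h, Ideal.isCoprime_iff_sup_eq, bot_sup_eq] at h1
  exact hproper _ h1

/-- The Chinese remainder theorem; this independence makes the densities multiply in the upper
bound. -/
lemma surjective_quotient_pi {R : Type*} [CommRing R] {𝔟 : ℕ → Ideal R}
    (hcoprime : Pairwise fun i j => IsCoprime (𝔟 i) (𝔟 j)) (L : ℕ) :
    Function.Surjective fun (a : R) (i : Fin L) => Ideal.Quotient.mk (𝔟 i) a := by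
  intro x
  obtain ⟨r, hr⟩ := Ideal.pi_quotient_surjective (I := fun i : Fin L => 𝔟 i)
    (fun i j hij => hcoprime (Fin.val_injective.ne hij)) x
  exact ⟨r, funext hr⟩

variable {K : Type*} [Field K] [NumberField K]

lemma absNorm_eq_natCard (𝔞 : Ideal (𝓞 K)) : Ideal.absNorm 𝔞 = Nat.card (𝓞 K ⧸ 𝔞) := by
  rw [Ideal.absNorm_apply, Submodule.cardQuot_apply]

lemma mem_admissibleSubshift_iff {𝔟 : ℕ → Ideal (𝓞 K)} (hbot : ∀ ℓ, 𝔟 ℓ ≠ ⊥)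
    (x : 𝓞 K → Fin 2) :
    x ∈ (admissibleSubshift 𝔟).carrier ↔
      ∀ ℓ, ∃ c : 𝓞 K ⧸ 𝔟 ℓ, ∀ a, x a ≠ 0 → Ideal.Quotient.mk (𝔟 ℓ) a ≠ c :=
  forall_congr' fun ℓ => residueCount_lt_iff (hbot ℓ) _

open scoped Classical in
/-- The patterns of `X_𝔅` on `E` are determined by a choice of omitted classes modulo the first `L`
ideals and by a subset of what remains of `E`. -/
lemma traceCount_admissibleSubshift_le {𝔟 : ℕ → Ideal (𝓞 K)} (hbot : ∀ ℓ, 𝔟 ℓ ≠ ⊥) (L : ℕ)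
    (E : Finset (𝓞 K)) {M : ℝ}
    (hM : ∀ c : ∀ i : Fin L, 𝓞 K ⧸ 𝔟 i,
      ((E.filter fun a => ∀ i : Fin L, Ideal.Quotient.mk (𝔟 i) a ≠ c i).card : ℝ) ≤ M) :
    (traceCount (admissibleSubshift 𝔟) E : ℝ) ≤
      Nat.card (∀ i : Fin L, 𝓞 K ⧸ 𝔟 i) * (2 : ℝ) ^ M := by
  have := fun ℓ => Ideal.finiteQuotientOfFreeOfNeBot (𝔟 ℓ) (hbot ℓ)
  have := fun ℓ => Fintype.ofFinite (𝓞 K ⧸ 𝔟 ℓ)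
  let P : (∀ i : Fin L, 𝓞 K ⧸ 𝔟 i) → Finset (𝓞 K) := fun c =>
    E.filter fun a => ∀ i : Fin L, Ideal.Quotient.mk (𝔟 i) a ≠ c i
  have hsub : trace E '' (admissibleSubshift 𝔟).carrier ⊆
      (Finset.univ.biUnion fun c => (P c).powerset : Finset (Finset (𝓞 K))) := by
    rintro _ ⟨x, hx, rfl⟩
    choose c hc using (mem_admissibleSubshift_iff hbot x).1 hx
    simp only [Finset.coe_biUnion, Set.mem_iUnion, Finset.mem_coe, Finset.mem_powerset]
    refine ⟨fun i => c i, Finset.mem_univ _, fun a ha => ?_⟩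
    obtain ⟨haE, hax⟩ := Finset.mem_filter.1 ha
    exact Finset.mem_filter.2 ⟨haE, fun i => hc i a hax⟩
  have h1 : traceCount (admissibleSubshift 𝔟) E ≤ ∑ c, 2 ^ (P c).card := by
    refine (Set.ncard_le_ncard hsub (Finset.finite_toSet _)).trans ?_
    rw [Set.ncard_coe_finset]
    refine Finset.card_biUnion_le.trans (le_of_eq ?_)
    simp
  have h2 : (traceCount (admissibleSubshift 𝔟) E : ℝ) ≤ ∑ c, (2 : ℝ) ^ (P c).card := by
    exact_mod_cast h1
  refine h2.trans ?_
  rw [Nat.card_eq_fintype_card, ← nsmul_eq_mul, ← Finset.card_univ, ← Finset.sum_const]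
  refine Finset.sum_le_sum fun c _ => ?_
  rw [← Real.rpow_natCast]
  exact Real.rpow_le_rpow_of_exponent_le one_le_two (hM c)

variable {𝔟 : ℕ → Ideal (𝓞 K)}

lemma two_le_absNorm {𝔞 : Ideal (𝓞 K)} (hproper : 𝔞 ≠ ⊤) (hbot : 𝔞 ≠ ⊥) :
    2 ≤ Ideal.absNorm 𝔞 := by
  have h0 : Ideal.absNorm 𝔞 ≠ 0 := fun h => hbot (Ideal.absNorm_eq_zero_iff.1 h)
  have h1 : Ideal.absNorm 𝔞 ≠ 1 := fun h => hproper (Ideal.absNorm_eq_one_iff.1 h)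
  omega

/-- The cardinalities of a Følner sequence tend to infinity. -/
lemma IsFoelnerSeq.tendsto_card_atTop {F : ℕ → Finset (𝓞 K)} (hF : IsFoelnerSeq F)
    (hproper : ∀ ℓ, 𝔟 ℓ ≠ ⊤) (hcoprime : Pairwise fun i j => IsCoprime (𝔟 i) (𝔟 j)) :
    Tendsto (fun n => ((F n).card : ℝ)) atTop atTop := by
  have hbot := ne_bot_of_pairwise_isCoprime hproper hcoprime
  have := fun ℓ => Ideal.finiteQuotientOfFreeOfNeBot (𝔟 ℓ) (hbot ℓ)
  have := fun ℓ => Fintype.ofFinite (𝓞 K ⧸ 𝔟 ℓ)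
  refine tendsto_atTop.2 fun B => ?_
  -- The quotient by the first `L` ideals has at least `2 ^ L` elements, and `|F n|` is eventually
  -- at least half of its size.
  obtain ⟨L, hL⟩ := pow_unbounded_of_one_lt (2 * B) (one_lt_two (α := ℝ))
  filter_upwards [hF.eventually_card_quotient_le (AddMonoidHom.mk'
    (fun a (i : Fin L) => Ideal.Quotient.mk (𝔟 i) a) (fun a b => by ext; simp))
    (surjective_quotient_pi hcoprime L)] with n hn
  have h2 : 2 ^ L ≤ Fintype.card (∀ i : Fin L, 𝓞 K ⧸ 𝔟 i) := by
    rw [Fintype.card_pi]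
    refine le_trans (le_of_eq ?_) (Finset.prod_le_prod' fun i _ =>
      (two_le_absNorm (hproper i) (hbot i)).trans_eq
        ((absNorm_eq_natCard _).trans Nat.card_eq_fintype_card))
    simp
  have h3 : (2 : ℝ) ^ L ≤ Fintype.card (∀ i : Fin L, 𝓞 K ⧸ 𝔟 i) := by exact_mod_cast h2
  linarith

/-- The lower bound: the entropy of the partition at the origin. -/
lemma le_coverRate_originCover (hbot : ∀ ℓ, 𝔟 ℓ ≠ ⊥) {h : ℝ}
    (hh : ∀ L, h ≤ ∏ ℓ ∈ Finset.range L, (1 - 1 / (Ideal.absNorm (𝔟 ℓ) : ℝ)))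
    {F : Finset (𝓞 K)} (hF : 0 < F.card) :
    h ≤ coverRate (shiftOn (admissibleSubshift 𝔟)) (originCover (admissibleSubshift 𝔟)) F := by
  have := fun ℓ => Ideal.finiteQuotientOfFreeOfNeBot (𝔟 ℓ) (hbot ℓ)
  simp only [absNorm_eq_natCard] at hh
  obtain ⟨A, hAF, hcard, hA⟩ := exists_subset_avoiding (fun ℓ => Ideal.Quotient.mk (𝔟 ℓ)) F hh
  have h1 := two_pow_card_le_coverNumber (admissibleSubshift 𝔟) hAF fun x hx =>
    (mem_admissibleSubshift_iff hbot x).2 fun ℓ => (hA ℓ).imp fun c hc a ha => hc a (hx ha)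
  have h2 : (2 : ℝ) ^ A.card ≤ coverNumber (coverJoin (shiftOn (admissibleSubshift 𝔟))
      (originCover (admissibleSubshift 𝔟)) F) := by exact_mod_cast h1
  have hpos : (0 : ℝ) < F.card := by exact_mod_cast hF
  rw [coverRate, le_div_iff₀ hpos]
  refine hcard.trans ?_
  rw [Real.le_logb_iff_rpow_le one_lt_two (lt_of_lt_of_le (by positivity) h2), Real.rpow_natCast]
  exact h2

/-- The upper bound: along a Følner sequence no open cover has an entropy above
`∏_{ℓ < L} (1 - 1 / N(𝔟 ℓ))`. -/
lemma eventually_coverRate_le (hproper : ∀ ℓ, 𝔟 ℓ ≠ ⊤)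
    (hcoprime : Pairwise fun i j => IsCoprime (𝔟 i) (𝔟 j)) {F : ℕ → Finset (𝓞 K)}
    (hF : IsFoelnerSeq F) {𝒰 : Set (Set (admissibleSubshift 𝔟).carrier)} (h𝒰 : IsOpenCover 𝒰)
    (L : ℕ) {z : ℝ}
    (hz : ∏ ℓ ∈ Finset.range L, (1 - 1 / (Ideal.absNorm (𝔟 ℓ) : ℝ)) < z) :
    ∀ᶠ n in atTop, coverRate (shiftOn (admissibleSubshift 𝔟)) 𝒰 (F n) ≤ z := by
  classical
  have hbot := ne_bot_of_pairwise_isCoprime hproper hcoprime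
  have := fun ℓ => Ideal.finiteQuotientOfFreeOfNeBot (𝔟 ℓ) (hbot ℓ)
  obtain ⟨W, hW⟩ := exists_window _ h𝒰
  simp only [absNorm_eq_natCard] at hz
  rw [Finset.prod_range] at hz
  set p := ∏ i : Fin L, (1 - 1 / (Nat.card (𝓞 K ⧸ 𝔟 i) : ℝ))
  set q : ℝ := ((Nat.card (∀ i : Fin L, 𝓞 K ⧸ 𝔟 i) : ℕ) : ℝ)
  have hq : 0 < q := Nat.cast_pos.2 Nat.card_pos
  -- One `ε` each for the density estimate, the boundary `D`, and the term `logb 2 q / |F n|`.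
  obtain ⟨ε, hε, hεz⟩ : ∃ ε > 0, p + 3 * ε = z := ⟨(z - p) / 3, by linarith, by ring⟩
  have hdens := hF.eventually_card_avoiding_le
    (fun i : Fin L => (Ideal.Quotient.mk (𝔟 i)).toAddMonoidHom)
    (surjective_quotient_pi hcoprime L) hε
  -- Summed over `W` this stays below `ε * |F n|`; the `+ 1` covers an empty `W`.
  have hbdry : ∀ᶠ n in atTop, ∀ w ∈ W,
      (((F n).image (w + ·) \ F n).card : ℝ) ≤ ε / (W.card + 1) * (F n).card :=
    (Filter.eventually_all_finset W).2 fun w _ =>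
      hF.eventually_card_sdiff_le w (by positivity)
  filter_upwards [hdens, hbdry, hF.eventually_card_pos,
    (hF.tendsto_card_atTop hproper hcoprime).eventually_ge_atTop (Real.logb 2 q / ε)]
    with n hn hb hpos hlarge
  have hpos' : (0 : ℝ) < (F n).card := by exact_mod_cast hpos
  set D := W.biUnion fun w => (F n).image (w + ·) \ F n
  have hD : (D.card : ℝ) ≤ ε * (F n).card := by
    have h1 : (D.card : ℝ) ≤ ∑ w ∈ W, (((F n).image (w + ·) \ F n).card : ℝ) := by
      exact_mod_cast Finset.card_biUnion_le
    refine h1.trans ((Finset.sum_le_sum hb).trans ?_)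
    rw [Finset.sum_const, nsmul_eq_mul, ← mul_assoc]
    refine mul_le_mul_of_nonneg_right ?_ hpos'.le
    rw [mul_div_assoc', div_le_iff₀ (by positivity)]
    nlinarith
  have hcover : coverNumber (coverJoin (shiftOn (admissibleSubshift 𝔟)) 𝒰 (F n)) ≤
      traceCount (admissibleSubshift 𝔟) (F n ∪ D) := by
    refine coverNumber_le_traceCount _ hW fun a ha w hw => ?_
    by_cases h : a + w ∈ F n
    · exact Finset.mem_union_left _ h
    · refine Finset.mem_union_right _ (Finset.mem_biUnion.2 ⟨w, hw, Finset.mem_sdiff.2 ⟨?_, h⟩⟩)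
      exact Finset.mem_image.2 ⟨a, ha, add_comm _ _⟩
  have htrace := traceCount_admissibleSubshift_le hbot L (F n ∪ D)
    (M := (p + ε) * (F n).card + ε * (F n).card) (fun c => by
      refine le_trans ?_ (add_le_add (hn c) hD)
      rw [Finset.filter_union]
      norm_cast
      exact (Finset.card_union_le _ _).trans
        (Nat.add_le_add_left (Finset.card_le_card (Finset.filter_subset _ _)) _))
  have hle : (coverNumber (coverJoin (shiftOn (admissibleSubshift 𝔟)) 𝒰 (F n)) : ℝ) ≤
      q * 2 ^ ((p + ε) * (F n).card + ε * (F n).card) :=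
    le_trans (by exact_mod_cast hcover) htrace
  have hp : 0 ≤ p := Finset.prod_nonneg fun i _ => by
    have : (1 : ℝ) ≤ Nat.card (𝓞 K ⧸ 𝔟 i) := by exact_mod_cast Nat.card_pos
    rw [sub_nonneg, div_le_one (by linarith)]
    exact this
  rw [coverRate, div_le_iff₀ hpos']
  -- A zero cover number is harmless, as `logb 2 0 = 0`.
  rcases Nat.eq_zero_or_pos
    (coverNumber (coverJoin (shiftOn (admissibleSubshift 𝔟)) 𝒰 (F n))) with h0 | h0
  · rw [h0, Nat.cast_zero, Real.logb_zero, ← hεz]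
    positivity
  · have h0' : (0 : ℝ) < coverNumber (coverJoin (shiftOn (admissibleSubshift 𝔟)) 𝒰 (F n)) := by
      exact_mod_cast h0
    refine (Real.logb_le_logb_of_le one_lt_two h0' hle).trans ?_
    rw [Real.logb_mul hq.ne' (by positivity), Real.logb_rpow two_pos (by norm_num)]
    rw [div_le_iff₀ hε] at hlarge
    rw [← hεz]
    linarith

end Admissible

end BFree

theorem theoremB {K : Type*} [Field K] [NumberField K] (𝔟 : ℕ → Ideal (𝓞 K))
    (hproper : ∀ ℓ, 𝔟 ℓ ≠ ⊤)
    (hcoprime : Pairwise fun i j => IsCoprime (𝔟 i) (𝔟 j))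
    (hsummable : Summable fun ℓ => 1 / (Ideal.absNorm (𝔟 ℓ) : ℝ)) :
    ∃ h : ℝ, HasProd (fun ℓ => 1 - 1 / (Ideal.absNorm (𝔟 ℓ) : ℝ)) h ∧
      BFree.HasTopEntropy (BFree.shiftOn (BFree.admissibleSubshift 𝔟)) (h : EReal) := by
  have hbot := BFree.ne_bot_of_pairwise_isCoprime hproper hcoprime
  have hmul : Multipliable fun ℓ => 1 - 1 / (Ideal.absNorm (𝔟 ℓ) : ℝ) := by
    simpa only [sub_eq_add_neg] using Real.multipliable_one_add_of_summable hsummable.neg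
  obtain ⟨h, hh⟩ := hmul
  refine ⟨h, hh, BFree.exists_isFoelnerSeq_ringOfIntegers K, fun F hF => ?_⟩
  have htends := hh.tendsto_prod_nat
  have hfac : ∀ ℓ, 0 ≤ 1 - 1 / (Ideal.absNorm (𝔟 ℓ) : ℝ) ∧
      1 - 1 / (Ideal.absNorm (𝔟 ℓ) : ℝ) ≤ 1 := fun ℓ => by
    have h2 : (2 : ℝ) ≤ Ideal.absNorm (𝔟 ℓ) := by
      exact_mod_cast BFree.two_le_absNorm (hproper ℓ) (hbot ℓ)
    refine ⟨?_, sub_le_self _ (by positivity)⟩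
    rw [sub_nonneg, div_le_one (by linarith)]
    linarith
  have hanti : Antitone fun L => ∏ ℓ ∈ Finset.range L, (1 - 1 / (Ideal.absNorm (𝔟 ℓ) : ℝ)) :=
    antitone_nat_of_succ_le fun L => by
      rw [Finset.prod_range_succ]
      exact mul_le_of_le_one_right (Finset.prod_nonneg fun ℓ _ => (hfac ℓ).1) (hfac L).2
  have hlower : (h : EReal) ≤ BFree.topEntropyInf (BFree.shiftOn (BFree.admissibleSubshift 𝔟)) F := by
    refine le_iSup₂_of_le _ (BFree.isOpenCover_originCover _) (le_liminf_of_le ?_ ?_)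
    · isBoundedDefault
    · filter_upwards [hF.eventually_card_pos] with n hn
      exact EReal.coe_le_coe_iff.2
        (BFree.le_coverRate_originCover hbot (fun L => hanti.le_of_tendsto htends L) hn)
  have hupper : BFree.topEntropySup (BFree.shiftOn (BFree.admissibleSubshift 𝔟)) F ≤ (h : EReal) := by
    refine iSup₂_le fun 𝒰 h𝒰 => EReal.le_of_forall_lt_iff_le.1 fun z hz => ?_
    -- Any `z > h` already exceeds some finite product, so finitely many ideals suffice for each
    -- `z`.
    obtain ⟨L, hL⟩ := (htends.eventually_lt_const (EReal.coe_lt_coe_iff.1 hz)).exists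
    refine limsup_le_of_le (by isBoundedDefault) ?_
    filter_upwards [BFree.eventually_coverRate_le hproper hcoprime hF h𝒰 L hL] with n hn
    exact EReal.coe_le_coe_iff.2 hn
  have hmid : BFree.topEntropyInf (BFree.shiftOn (BFree.admissibleSubshift 𝔟)) F ≤
      BFree.topEntropySup (BFree.shiftOn (BFree.admissibleSubshift 𝔟)) F :=
    iSup₂_mono fun _ _ => liminf_le_limsup
  exact ⟨hupper.antisymm (hlower.trans hmid), (hmid.trans hupper).antisymm hlower⟩
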